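/- An instance of the reward discounted travelling salesman problem (RD-TSP) with $n\ge 2$ rewards consists of an initial state $s_0$, reward states $s_1,\dots,s_n$, shortest-path distances $d$ between these states (finite, nonnegative, symmetric, zero on the diagonal, satisfying the triangle inequality) and a discount factor $\gamma\in(0,1)$. A walk starting at $s_0$ collects each reward once, at its first arrival there, and a reward first reached after travelling distance $t$ contributes $\gamma^{t}$ to the value of the walk. Let $\mathrm{OPT}$ be the maximum value over all orders of visiting the $n$ rewards. NN is the procedure that repeatedly moves to a nearest unvisited reward until all rewards are visited. The policy NN-RDFS flips a fair coin. On one outcome it runs NN from $s_0$. On the other it goes from $s_0$ to a reward chosen uniformly at random, independently draws $i$ uniformly from $\{1,2,\dots,\lfloor\log_2 n\rfloor\}$, sets $x=\log_{1/\gamma}2$, $n'=n/2^{i}$ and $\theta=x/\sqrt{n'}$, performs from the chosen reward a depth first search on the edges of length less than $\theta$ between rewards (moving to an unvisited neighbour if there is one, otherwise walking back to the parent, until the root has no unvisited neighbour), and then follows by NN. Let $\mathrm{NN\text{-}RDFS}$ denote also the expected value of this policy. **Theorem (NN-RDFS performance).** However ties in NN and the choices among unvisited neighbours in the depth first search are resolved: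 1. For every $\alpha>0$ there is a constant $c>0$, depending only on $\alpha$, such that for every $n\ge2$ and every instance with $n$ rewards and $\mathrm{OPT}\ge\alpha n$, $$\mathrm{NN\text{-}RDFS}\;\ge\; c\,\frac{n^{-1/2}}{\log^{2} n}\,\mathrm{OPT}.$$ 2. There is an absolute constant $c>0$ such that for every $n\ge2$ and every instance with $n$ rewards, $$\mathrm{NN\text{-}RDFS}\;\ge\; c\,\frac{n^{-2/3}}{\log^{2} n}\,\mathrm{OPT}.$$ -/

import Mathlib

/-- A reward discounted travelling salesman instance with `n` rewards. The nodes are the initial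
state `s₀`, represented by `none`, and the reward states `some i`, `i : Fin n`. The number `d u v`
is the length of a shortest path between `u` and `v` in the underlying undirected graph, so `d` is
a finite pseudometric on the nodes; `γ` is the discount factor. -/
structure RDTSP (n : ℕ) where
  d : Option (Fin n) → Option (Fin n) → ℝ
  d_self : ∀ u, d u u = 0
  d_nonneg : ∀ u v, 0 ≤ d u v
  d_symm : ∀ u v, d u v = d v u
  d_triangle : ∀ u v w, d u w ≤ d u v + d v w
  γ : ℝ
  γ_pos : 0 < γ
  γ_lt_one : γ < 1

/-- A rule for resolving the choices that an algorithm leaves open: given the history (the rewards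
visited so far, in order) and a nonempty finite set of admissible next rewards, it selects one of
them. -/
def Selector (n : ℕ) : Type :=
  List (Fin n) → ∀ S : Finset (Fin n), S.Nonempty → {i : Fin n // i ∈ S}

namespace RDTSP

variable {n : ℕ} (I : RDTSP n)

/-! ### Walks and their discounted return

A walk is recorded as the list of rewards at which it successively arrives (rewards may be
revisited); every walk starts at `s₀`. -/

/-- The length of the walk through the given sequence of nodes. -/
def walkLength : List (Option (Fin n)) → ℝ
  | [] => 0
  | [_] => 0
  | u :: v :: l => I.d u v + walkLength (v :: l)

/-- The distance travelled from `s₀` along the walk `w` until it first arrives at reward `i`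
(for `i` on `w`). -/
def arrival (w : List (Fin n)) (i : Fin n) : ℝ :=
  I.walkLength (none :: (w.take (w.idxOf i + 1)).map some)

/-- The discounted return of a walk: every reward on it is collected once, at the first arrival.
If `w` lists each reward exactly once, `w = [i₁, …, iₙ]`, this is
`∑ j, γ ^ (d s₀ i₁ + d i₁ i₂ + ⋯ + d iⱼ₋₁ iⱼ)`. -/
noncomputable def value (w : List (Fin n)) : ℝ :=
  ∑ i ∈ w.toFinset, I.γ ^ I.arrival w i

/-- The optimal discounted return over all orders of visiting the `n` rewards. -/
noncomputable def opt : ℝ :=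
  ⨆ π : Equiv.Perm (Fin n), I.value (List.ofFn π)

/-! ### Nearest neighbour -/

/-- The rewards that do not occur on `w`. -/
def unvisited (w : List (Fin n)) : Finset (Fin n) :=
  Finset.univ.filter fun i => i ∉ w

/-- The unvisited rewards at minimal distance from the current position, which is the last entry
of `w`, or `s₀` if `w` is empty. -/
noncomputable def nearest (w : List (Fin n)) : Finset (Fin n) :=
  (unvisited w).filter fun i =>
    ∀ j ∈ unvisited w, I.d w.getLast? (some i) ≤ I.d w.getLast? (some j)

theorem nearest_nonempty {w : List (Fin n)} (h : (unvisited w).Nonempty) :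
    (I.nearest w).Nonempty := by
  obtain ⟨i, hi, hmin⟩ :=
    Finset.exists_min_image (unvisited w) (fun i => I.d w.getLast? (some i)) h
  exact ⟨i, Finset.mem_filter.2 ⟨hi, hmin⟩⟩

theorem card_unvisited_append_lt {w : List (Fin n)} {i : Fin n} (h : i ∉ w) :
    (unvisited (w ++ [i])).card < (unvisited w).card := by
  refine Finset.card_lt_card ((Finset.ssubset_iff_of_subset ?_).2 ⟨i, ?_, ?_⟩)
  · intro j hj
    simp only [unvisited, Finset.mem_filter, Finset.mem_univ, true_and, List.mem_append] at hj ⊢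
    exact fun h' => hj (Or.inl h')
  · simpa [unvisited] using h
  · simp [unvisited]

theorem card_unvisited_append_le (w l : List (Fin n)) :
    (unvisited (w ++ l)).card ≤ (unvisited w).card := by
  refine Finset.card_le_card ?_
  intro j hj
  simp only [unvisited, Finset.mem_filter, Finset.mem_univ, true_and, List.mem_append] at hj ⊢
  exact fun h' => hj (Or.inl h')

/-- Continue the walk `w` by NN: as long as there are unvisited rewards, move to a nearest one
(ties are resolved by `τ`). -/
noncomputable def nn (τ : Selector n) (w : List (Fin n)) : List (Fin n) :=
  if h : (unvisited w).Nonempty then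
    nn τ (w ++ [(τ w (I.nearest w) (I.nearest_nonempty h)).1])
  else w
termination_by (unvisited w).card
decreasing_by
  have hm := Finset.mem_filter.1 (τ w (I.nearest w) (I.nearest_nonempty h)).2
  exact card_unvisited_append_lt (Finset.mem_filter.1 hm.1).2

/-! ### Depth first search on short edges -/

/-- The rewards not on `w` that are joined to the reward `v` by an edge shorter than `θ`. -/
noncomputable def newNeighbors (θ : ℝ) (v : Fin n) (w : List (Fin n)) : Finset (Fin n) :=
  (unvisited w).filter fun i => I.d (some v) (some i) < θ

/-- Depth first search on the edges shorter than `θ` between rewards. The first argument is the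
stack: its head is the current position and the rest is the tree path back to the root. The second
argument is the walk so far. If the current reward has a new neighbour, the search moves to one
(selected by `σ`); otherwise it walks back to the parent, and it ends when the root has no new
neighbour. -/
noncomputable def dfs (θ : ℝ) (σ : Selector n) : List (Fin n) → List (Fin n) → List (Fin n)
  | [], w => w
  | v :: st, w =>
    if h : (I.newNeighbors θ v w).Nonempty then
      dfs θ σ ((σ w (I.newNeighbors θ v w) h).1 :: v :: st)
        (w ++ [(σ w (I.newNeighbors θ v w) h).1])
    else dfs θ σ st (w ++ st.head?.toList)
termination_by st w => 2 * (unvisited w).card + st.length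
decreasing_by
  · have hm := Finset.mem_filter.1 (σ w (I.newNeighbors θ v w) h).2
    have hlt := card_unvisited_append_lt (Finset.mem_filter.1 hm.1).2
    simp only [List.length_cons]
    omega
  · have hle := card_unvisited_append_le w st.head?.toList
    simp only [List.length_cons]
    omega

/-! ### The policy NN-RDFS -/

/-- `x = log_{1/γ} 2`, the distance over which the discount is `1 / 2`. -/
noncomputable def halfLength : ℝ := Real.logb (1 / I.γ) 2

/-- The threshold `θ = x / √n'` for the guess `n' = n / 2 ^ i`. -/
noncomputable def threshold (i : ℕ) : ℝ :=
  I.halfLength / Real.sqrt ((n : ℝ) / 2 ^ i)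

/-- The walk of RDFS for the first reward `s₁` and the threshold `θ`: go from `s₀` to `s₁`, perform
the depth first search from `s₁` on edges shorter than `θ`, and follow by NN. -/
noncomputable def rdfs (τ σ : Selector n) (θ : ℝ) (s₁ : Fin n) : List (Fin n) :=
  I.nn τ (I.dfs θ σ [s₁] [s₁])

/-- The expected discounted return of NN-RDFS: with probability `1 / 2` run NN from `s₀`, and with
probability `1 / 2` run RDFS with `s₁` uniform among the `n` rewards and, independently, `i` uniform
in `{1, …, ⌊log₂ n⌋}`. -/
noncomputable def nnRdfs (τ σ : Selector n) : ℝ :=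
  1 / 2 * I.value (I.nn τ []) +
    1 / 2 * (1 / (n : ℝ) * ∑ s₁ : Fin n,
      (1 / (Nat.log 2 n : ℝ) * ∑ i ∈ Finset.Icc 1 (Nat.log 2 n),
        I.value (I.rdfs τ σ (I.threshold i) s₁)))

end RDTSP

/-!
Write `x = log_{1/γ} 2`, let `p` be the discount of a reward nearest to `s₀`, and cut an optimal
tour into segments of length `x`, numbered from the time of that discount on. With summable weights
`(4 / 5) ^ l`, some segment `l`, with `k` rewards, has `p * 2⁻ˡ * k ≥ OPT / 5 * (4 / 5) ^ l`
(`RDTSP.exists_segment`).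

NN collects at least `p`, from its first reward (`RDTSP.exists_nearest_le_value_nn`).

For RDFS, suppose that `n' = n / 2 ^ i` equals `k` up to a factor two; one of the guesses `i` is
such. At most `√n'` steps of the optimal tour within the segment have length `θ = x / √n'` or more,
so that the segment consists of at most `√n' + 1` blocks whose rewards are joined by short steps.
Hence a random reward of the segment lies in a block of about `√k` rewards on average
(`RDTSP.le_sum_min_card_fiber`). A depth first search from there visits the whole block
(`RDTSP.mem_dfs_of_dist_lt`), and at least half of the entries in every initial part of its walk are
new (`RDTSP.length_take_dfs_le`), so that within distance `O(x)` it collects about `√k` rewards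
(`RDTSP.le_value_rdfs`). The start is in the segment with probability `k / n` and the guess is right
with probability at least `1 / log₂ n`; thus the expected value is at least a constant times
`p * 2⁻ˡ * k * √k / (n log n)` (`RDTSP.exists_segment_bounds`).

If `OPT ≥ α n`, then `k ≥ α n / 5`, while `p` and `2⁻ˡ` are bounded below in terms of `α`, and the
second bound suffices (`RDTSP.le_nnRdfs_of_le_opt`). In general the two bounds are combined
(`RDTSP.le_nnRdfs`): NN is good for small `k`, RDFS for large `k`, and they meet at `k = n ^ (2 / 3)`.
In fact both arguments lose only one factor `log n`; the second one in the theorem is not needed.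
-/

namespace RDTSP

variable {n : ℕ} (I : RDTSP n)

/-! ### Lengths and values of walks -/

theorem walkLength_take (l : List (Option (Fin n))) (m : ℕ) (h : m < l.length) :
    I.walkLength (l.take (m + 1)) =
      ∑ k ∈ Finset.range m, I.d (l.getD k none) (l.getD (k + 1) none) := by
  induction l generalizing m with
  | nil => simp at h
  | cons u l ih =>
    cases m with
    | zero => simp [walkLength]
    | succ m =>
      cases l with
      | nil => simp at h
      | cons v l =>
        have h' := ih m (by simpa using h)
        simp only [List.take_succ_cons] at h' ⊢
        rw [walkLength, h', Finset.sum_range_succ', add_comm]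
        simp

theorem walkLength_map_some_le {θ : ℝ} (s : Fin n) (p : List (Fin n))
    (h : (s :: p).IsChain fun u v => I.d (some u) (some v) ≤ θ) :
    I.walkLength ((s :: p).map some) ≤ p.length * θ := by
  induction p generalizing s with
  | nil => simp [walkLength]
  | cons v p ih =>
    rw [List.isChain_cons_cons] at h
    have := ih v h.2
    simp only [List.map_cons, walkLength, List.length_cons] at this ⊢
    push_cast
    linarith [h.1]

theorem arrival_of_prefix {w w' : List (Fin n)} (h : w <+: w') {i : Fin n} (hi : i ∈ w) :
    I.arrival w' i = I.arrival w i := by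
  obtain ⟨l, rfl⟩ := h
  unfold arrival
  rw [List.idxOf_append_of_mem hi, List.take_append_of_le_length]
  exact List.idxOf_lt_length_iff.2 hi

theorem value_le_of_prefix {w w' : List (Fin n)} (h : w <+: w') : I.value w ≤ I.value w' := by
  have hs : w.toFinset ⊆ w'.toFinset := fun i hi => by
    simp only [List.mem_toFinset] at hi ⊢
    exact h.subset hi
  unfold value
  rw [← Finset.sum_congr rfl fun i hi =>
    congrArg (I.γ ^ ·) (I.arrival_of_prefix h (List.mem_toFinset.1 hi))]
  exact Finset.sum_le_sum_of_subset_of_nonneg hs fun _ _ _ => Real.rpow_nonneg I.γ_pos.le _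

theorem value_nonneg (w : List (Fin n)) : 0 ≤ I.value w :=
  Finset.sum_nonneg fun _ _ => Real.rpow_nonneg I.γ_pos.le _

theorem prefix_nn (τ : Selector n) (w : List (Fin n)) : w <+: I.nn τ w := by
  induction w using nn.induct I τ with
  | case1 w h ih =>
    rw [nn, dif_pos h]
    exact (List.prefix_append _ _).trans ih
  | case2 w h => rw [nn, dif_neg h]

/-- NN starts with a reward nearest to `s₀`, and collects at least that one. -/
theorem exists_nearest_le_value_nn (τ : Selector n) (hn : 0 < n) :
    ∃ i₀ : Fin n, (∀ j, I.d none (some i₀) ≤ I.d none (some j)) ∧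
      I.γ ^ I.d none (some i₀) ≤ I.value (I.nn τ []) := by
  have h : (unvisited ([] : List (Fin n))).Nonempty := ⟨⟨0, hn⟩, by simp [unvisited]⟩
  set a := τ [] (I.nearest []) (I.nearest_nonempty h) with ha
  have hm := (Finset.mem_filter.1 a.2).2
  refine ⟨a.1, fun j => by simpa using hm j (by simp [unvisited]), ?_⟩
  have hp : [a.1] <+: I.nn τ [] := by
    rw [nn, dif_pos h]
    exact I.prefix_nn τ _
  refine le_trans (le_of_eq ?_) (I.value_le_of_prefix hp)
  simp [value, arrival, walkLength]

/-! ### Depth first search -/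

theorem newNeighbors_append_subset (θ : ℝ) (v : Fin n) (w l : List (Fin n)) :
    I.newNeighbors θ v (w ++ l) ⊆ I.newNeighbors θ v w := by
  intro j
  simp only [newNeighbors, unvisited, Finset.mem_filter, List.mem_append]
  tauto

theorem prefix_dfs (θ : ℝ) (σ : Selector n) (st w : List (Fin n)) : w <+: I.dfs θ σ st w := by
  induction st, w using dfs.induct I θ σ with
  | case1 w => rw [dfs]
  | case2 v st w h ih =>
    rw [dfs, dif_pos h]
    exact (List.prefix_append _ _).trans ih
  | case3 v st w h ih =>
    rw [dfs, dif_neg h]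
    exact (List.prefix_append _ _).trans ih

/-- Every reward that has left the stack has all its neighbours on the walk, so that at the end of
the search the visited set is closed under short edges. -/
theorem mem_dfs_of_dist_lt (θ : ℝ) (σ : Selector n) (st w : List (Fin n))
    (h : ∀ v ∈ w, v ∈ st ∨ I.newNeighbors θ v w = ∅) (hst : ∀ v ∈ st, v ∈ w) :
    ∀ v ∈ I.dfs θ σ st w, ∀ u, I.d (some v) (some u) < θ → u ∈ I.dfs θ σ st w := by
  induction st, w using dfs.induct I θ σ with
  | case1 w =>
    rw [dfs]
    intro v hv u hu
    by_contra hc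
    have := (h v hv).resolve_left (by simp)
    exact Finset.notMem_empty u (this ▸ by simp [newNeighbors, unvisited, hu, hc])
  | case2 v st w hne ih =>
    rw [dfs, dif_pos hne]
    apply ih
    · intro u hu
      rcases List.mem_append.1 hu with hu | hu
      · rcases h u hu with h' | h'
        · exact Or.inl (List.mem_cons_of_mem _ h')
        · exact Or.inr (Finset.subset_empty.1 (h' ▸ I.newNeighbors_append_subset θ u w _))
      · exact Or.inl (by simp_all)
    · intro u hu
      rcases List.mem_cons.1 hu with hu | hu
      · simp [hu]
      · exact List.mem_append_left _ (hst u hu)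
  | case3 v st w hne ih =>
    rw [dfs, dif_neg hne]
    rw [Finset.not_nonempty_iff_eq_empty] at hne
    have key : ∀ u ∈ w, u ∈ st ∨ I.newNeighbors θ u (w ++ st.head?.toList) = ∅ := by
      intro u hu
      have : u ∈ st ∨ I.newNeighbors θ u w = ∅ := by
        rcases h u hu with h' | h'
        · rcases List.mem_cons.1 h' with rfl | h'
          · exact Or.inr hne
          · exact Or.inl h'
        · exact Or.inr h'
      exact this.imp_right fun (h' : I.newNeighbors θ u w = ∅) =>
        Finset.subset_empty.1 (h' ▸ I.newNeighbors_append_subset θ u w _)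
    have hst' : ∀ u ∈ st, u ∈ w := fun u hu => hst u (List.mem_cons_of_mem _ hu)
    have hw : ∀ u ∈ w ++ st.head?.toList, u ∈ w := by
      intro u hu
      rcases List.mem_append.1 hu with hu | hu
      · exact hu
      · exact hst' u (List.mem_of_mem_head? (by simpa using hu))
    exact ih (fun u hu => key u (hw u hu)) fun u hu => List.mem_append_left _ (hst' u hu)

/-- Consecutive rewards on the walk of a depth first search are joined by short edges. -/
theorem isChain_dfs (θ : ℝ) (σ : Selector n) (st w : List (Fin n))
    (hw : w.IsChain fun u v => I.d (some u) (some v) ≤ θ)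
    (hst : st.IsChain fun u v => I.d (some u) (some v) ≤ θ)
    (hh : ∀ v ∈ st.head?, w.getLast? = some v) :
    (I.dfs θ σ st w).IsChain fun u v => I.d (some u) (some v) ≤ θ := by
  induction st, w using dfs.induct I θ σ with
  | case1 w => rwa [dfs]
  | case2 v st w hne ih =>
    rw [dfs, dif_pos hne]
    set a := σ w (I.newNeighbors θ v w) hne with ha
    have had : I.d (some v) (some a.1) ≤ θ := (Finset.mem_filter.1 a.2).2.le
    have hl : w.getLast? = some v := hh v rfl
    apply ih
    · refine List.isChain_append.2 ⟨hw, List.isChain_singleton _, ?_⟩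
      intro x hx y hy
      rw [hl] at hx
      simp only [Option.mem_def, Option.some.injEq, List.head?_cons] at hx hy
      subst hx hy
      exact had
    · rw [List.isChain_cons_cons]
      exact ⟨by rwa [I.d_symm], hst⟩
    · intro u hu
      simp only [List.head?_cons, Option.mem_def, Option.some.injEq] at hu
      simp [← hu]
  | case3 v st w hne ih =>
    rw [dfs, dif_neg hne]
    have hl : w.getLast? = some v := hh v rfl
    cases st with
    | nil => exact ih (by simpa using hw) List.isChain_nil (by simp)
    | cons b st =>
      rw [List.isChain_cons_cons] at hst
      apply ih
      · refine List.isChain_append.2 ⟨hw, List.isChain_singleton _, ?_⟩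
        intro x hx y hy
        rw [hl] at hx
        simp only [Option.toList_some, Option.mem_def, Option.some.injEq, List.head?_cons] at hx hy
        subst hx hy
        exact hst.1
      · exact hst.2
      · simp

/-- A depth first search walks along each tree edge at most twice, hence every initial part of its
walk contains at least half as many distinct rewards as it has entries. The induction carries the
number of entries plus the height of the stack. -/
theorem length_take_dfs_le (θ : ℝ) (σ : Selector n) (st w : List (Fin n))
    (hw : ∀ m, (w.take m).length ≤ 2 * (w.take m).toFinset.card)
    (hst : w.length + st.length ≤ 2 * w.toFinset.card) :
    ∀ m, ((I.dfs θ σ st w).take m).length ≤ 2 * ((I.dfs θ σ st w).take m).toFinset.card := by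
  have snoc : ∀ (w : List (Fin n)) (a : Fin n),
      (∀ m, (w.take m).length ≤ 2 * (w.take m).toFinset.card) →
      (w ++ [a]).length ≤ 2 * (w ++ [a]).toFinset.card →
      ∀ m, ((w ++ [a]).take m).length ≤ 2 * ((w ++ [a]).take m).toFinset.card := by
    intro w a h1 h2 m
    rcases le_or_gt m w.length with hm | hm
    · rw [List.take_append_of_le_length hm]
      exact h1 m
    · rw [List.take_of_length_le (by simpa using hm)]
      exact h2
  induction st, w using dfs.induct I θ σ with
  | case1 w => rwa [dfs]
  | case2 v st w hne ih =>
    rw [dfs, dif_pos hne]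
    set a := σ w (I.newNeighbors θ v w) hne with ha
    have hna : a.1 ∉ w := by
      have := (Finset.mem_filter.1 (Finset.mem_filter.1 a.2).1).2
      exact this
    have hc : (w ++ [a.1]).toFinset.card = w.toFinset.card + 1 := by
      rw [List.toFinset_append, Finset.union_comm]
      simp [hna]
    simp only [List.length_cons] at hst
    apply ih
    · exact snoc w a.1 hw (by rw [hc]; simp; omega)
    · rw [hc]
      simp
      omega
  | case3 v st w hne ih =>
    rw [dfs, dif_neg hne]
    cases st with
    | nil => exact ih (by simpa using hw) (by simp at hst ⊢; omega)
    | cons b st =>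
      have hc : w.toFinset.card ≤ (w ++ [b]).toFinset.card :=
        Finset.card_le_card fun u hu => by simp_all
      simp only [List.length_cons] at hst
      apply ih
      · exact snoc w b hw (by simp only [List.length_append, List.length_singleton]; omega)
      · simp only [List.head?_cons, Option.toList_some, List.length_append, List.length_cons,
          List.length_nil]
        omega

/-- The value collected by RDFS: if `m` rewards can be reached from `s₁` by short edges, then the
first `L` steps of the search meet at least `min L m / 2` of them. -/
theorem le_value_rdfs (τ σ : Selector n) {θ : ℝ} (hθ : 0 < θ) (s₁ : Fin n) (L : ℕ)
    (F : Finset (Fin n)) (hF : ∀ V : Finset (Fin n), s₁ ∈ V →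
      (∀ v ∈ V, ∀ u, I.d (some v) (some u) < θ → u ∈ V) → F ⊆ V) :
    min (L : ℝ) F.card / 2 * I.γ ^ (I.d none (some s₁) + L * θ) ≤ I.value (I.rdfs τ σ θ s₁) := by
  set W := I.dfs θ σ [s₁] [s₁] with hW
  obtain ⟨p, hp⟩ : [s₁] <+: W := I.prefix_dfs θ σ _ _
  have hchain : W.IsChain fun u v => I.d (some u) (some v) ≤ θ :=
    I.isChain_dfs θ σ _ _ (by simp) (by simp) (by simp)
  have hclosed := I.mem_dfs_of_dist_lt θ σ [s₁] [s₁] (by simp) (by simp)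
  have hcard : (W.take L).length ≤ 2 * (W.take L).toFinset.card := by
    refine I.length_take_dfs_le θ σ _ _ (fun m => ?_) (by simp) L
    cases m <;> simp
  have hFW : F ⊆ W.toFinset := hF _ (by simp [← hp]) fun v hv u hu => by
    simp only [List.mem_toFinset] at hv ⊢
    exact hclosed v hv u hu
  have hmin : min (L : ℝ) F.card / 2 ≤ (W.take L).toFinset.card := by
    rcases le_or_gt L W.length with h | h
    · rw [List.length_take, min_eq_left h] at hcard
      have : (L : ℝ) ≤ 2 * (W.take L).toFinset.card := by exact_mod_cast hcard
      linarith [min_le_left (L : ℝ) F.card]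
    · rw [List.take_of_length_le h.le]
      have h1 : (F.card : ℝ) ≤ W.toFinset.card := by exact_mod_cast Finset.card_le_card hFW
      have h2 : (0 : ℝ) ≤ F.card := by positivity
      linarith [min_le_right (L : ℝ) F.card]
  have hpre : W.take L <+: I.rdfs τ σ θ s₁ := (List.take_prefix L W).trans (I.prefix_nn τ W)
  refine le_trans ?_ (I.value_le_of_prefix hpre)
  refine (mul_le_mul_of_nonneg_right hmin (Real.rpow_nonneg I.γ_pos.le _)).trans ?_
  rw [value, ← nsmul_eq_mul]
  refine Finset.card_nsmul_le_sum _ _ _ fun i hi => ?_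
  refine Real.rpow_le_rpow_of_exponent_ge I.γ_pos I.γ_lt_one.le ?_
  have hi' : i ∈ W.take L := List.mem_toFinset.1 hi
  set k := (W.take L).idxOf i with hk
  have hkl : k < (W.take L).length := List.idxOf_lt_length_iff.2 hi'
  rw [List.length_take] at hkl
  have hkL : k < L := lt_of_lt_of_le hkl (min_le_left _ _)
  have htake : (W.take L).take (k + 1) = s₁ :: p.take k := by
    rw [List.take_take, min_eq_left hkL, ← hp]
    simp
  have hch : (s₁ :: p.take k).IsChain fun u v => I.d (some u) (some v) ≤ θ := by
    rw [← htake]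
    exact (hchain.take L).take (k + 1)
  have hlen := I.walkLength_map_some_le s₁ _ hch
  rw [arrival, ← hk, htake]
  simp only [List.map_cons, walkLength] at hlen ⊢
  have : ((p.take k).length : ℝ) ≤ L := by
    exact_mod_cast (List.length_take_le k p).trans hkL.le
  have := mul_le_mul_of_nonneg_right this hθ.le
  linarith

/-! ### Steps of a tour and blocks of short steps -/

/-- The number of steps `k < m` whose length `e k` is at least `θ`. -/
noncomputable def longSteps (e : ℕ → ℝ) (θ : ℝ) (m : ℕ) : ℕ :=
  ((Finset.range m).filter fun k => θ ≤ e k).card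

theorem longSteps_succ (e : ℕ → ℝ) (θ : ℝ) (m : ℕ) :
    longSteps e θ (m + 1) = longSteps e θ m + if θ ≤ e m then 1 else 0 := by
  unfold longSteps
  rw [Finset.range_add_one, Finset.filter_insert]
  split_ifs with h
  · rw [Finset.card_insert_of_notMem (by simp)]
  · rfl

theorem longSteps_mono (e : ℕ → ℝ) (θ : ℝ) : Monotone (longSteps e θ) :=
  monotone_nat_of_le_succ fun m => by rw [longSteps_succ]; omega

theorem mul_longSteps_sub_le {e : ℕ → ℝ} (he : ∀ k, 0 ≤ e k) (θ : ℝ) {a c : ℕ} (hac : a ≤ c) :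
    θ * ((longSteps e θ c : ℝ) - longSteps e θ a) ≤
      ∑ k ∈ Finset.range c, e k - ∑ k ∈ Finset.range a, e k := by
  induction c, hac using Nat.le_induction with
  | base => simp
  | succ c hac ih =>
    rw [Finset.sum_range_succ, longSteps_succ]
    split_ifs with h
    · push_cast
      linarith
    · have := he c
      push_cast
      linarith

theorem iff_of_longSteps_eq {e : ℕ → ℝ} {θ : ℝ} {Q : ℕ → Prop} {N a c : ℕ} (ha : 1 ≤ a)
    (hac : a ≤ c) (hc : c ≤ N)
    (hQ : ∀ k, 1 ≤ k → k < N → e k < θ → (Q k ↔ Q (k + 1)))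
    (h : longSteps e θ a = longSteps e θ c) : Q a ↔ Q c := by
  induction c, hac using Nat.le_induction with
  | base => rfl
  | succ c hac ih =>
    have h1 := longSteps_mono e θ hac
    have h2 := longSteps_succ e θ c
    split_ifs at h2 with h3
    · omega
    · exact (ih (by omega) (by omega)).trans (hQ c (by omega) (by omega) (not_le.1 h3))

theorem card_image_le_of_sub_le {ι : Type*} {S : Finset ι} (hS : S.Nonempty) (b : ι → ℕ) {y : ℝ}
    (h : ∀ i ∈ S, ∀ j ∈ S, (b j : ℝ) - b i ≤ y) : ((S.image b).card : ℝ) ≤ y + 1 := by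
  obtain ⟨i, hi, hmin⟩ := S.exists_min_image b hS
  obtain ⟨j, hj, hmax⟩ := S.exists_max_image b hS
  have hsub : S.image b ⊆ Finset.Icc (b i) (b j) := by
    intro m hm
    obtain ⟨l, hl, rfl⟩ := Finset.mem_image.1 hm
    exact Finset.mem_Icc.2 ⟨hmin l hl, hmax l hl⟩
  have hc := Finset.card_le_card hsub
  rw [Nat.card_Icc] at hc
  have hij := hmin j hj
  have : (S.image b).card + b i ≤ b j + 1 := by omega
  have : ((S.image b).card : ℝ) + b i ≤ b j + 1 := by exact_mod_cast this
  linarith [h i hi j hj]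

/-- A random point of a set split into at most `B` blocks lies in a block of size about
`S.card / B` on average, even if the sizes are truncated at `t`. -/
theorem le_sum_min_card_fiber {ι : Type*} (S : Finset ι) (b : ι → ℕ) {B : ℝ} (t : ℝ)
    (hB : ((S.image b).card : ℝ) ≤ B) :
    t * S.card - B * t ^ 2 ≤
      ∑ v ∈ S, min t ((S.filter fun u => b u = b v).card : ℝ) := by
  rw [Finset.sum_comp (fun m => min t ((S.filter fun u => b u = m).card : ℝ)) b]
  have h1 : ∀ m ∈ S.image b, t * ((S.filter fun u => b u = m).card : ℝ) - t ^ 2 ≤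
      (S.filter fun u => b u = m).card • min t ((S.filter fun u => b u = m).card : ℝ) := by
    intro m _
    rw [nsmul_eq_mul]
    rcases le_total t ((S.filter fun u => b u = m).card : ℝ) with h | h
    · rw [min_eq_left h]
      nlinarith [sq_nonneg t]
    · rw [min_eq_right h]
      nlinarith [sq_nonneg (t - ((S.filter fun u => b u = m).card : ℝ)),
        sq_nonneg t, sq_nonneg ((S.filter fun u => b u = m).card : ℝ)]
  refine le_trans ?_ (Finset.sum_le_sum h1)
  rw [Finset.sum_sub_distrib, ← Finset.mul_sum, Finset.sum_const, nsmul_eq_mul, ← Nat.cast_sum,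
    ← Finset.card_eq_sum_card_image]
  nlinarith [sq_nonneg t]

/-- The nodes of the tour through all rewards in the order `π`, starting with `s₀`. The value
`none` past the end of the tour is never used. -/
def tourNode (π : Equiv.Perm (Fin n)) (k : ℕ) : Option (Fin n) :=
  (none :: (List.ofFn π).map some).getD k none

/-- The length of step `k` of the tour `π`. -/
def tourStep (π : Equiv.Perm (Fin n)) (k : ℕ) : ℝ :=
  I.d (tourNode π k) (tourNode π (k + 1))

theorem tourNode_succ (π : Equiv.Perm (Fin n)) (j : Fin n) :
    tourNode π (j + 1) = some (π j) := by
  simp [tourNode]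

/-- The time at which the tour `π` reaches the reward `π j`. -/
def tourTime (π : Equiv.Perm (Fin n)) (j : Fin n) : ℝ :=
  ∑ k ∈ Finset.range (j + 1), I.tourStep π k

theorem tourStep_nonneg (π : Equiv.Perm (Fin n)) (k : ℕ) : 0 ≤ I.tourStep π k :=
  I.d_nonneg _ _

theorem arrival_ofFn (π : Equiv.Perm (Fin n)) (j : Fin n) :
    I.arrival (List.ofFn π) (π j) = I.tourTime π j := by
  have hidx : (List.ofFn π).idxOf (π j) = j := by
    have := (List.nodup_ofFn.2 π.injective).idxOf_getElem j (by simp)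
    simpa using this
  have := I.walkLength_take (none :: (List.ofFn π).map some) (j + 1) (by simp)
  rw [arrival, hidx]
  simpa [tourTime, tourStep, tourNode, List.map_take] using this

theorem value_ofFn (π : Equiv.Perm (Fin n)) :
    I.value (List.ofFn π) = ∑ j, I.γ ^ I.tourTime π j := by
  have huniv : (List.ofFn π).toFinset = Finset.univ := by
    ext i
    simp only [List.mem_toFinset, List.mem_ofFn, Finset.mem_univ, iff_true]
    exact ⟨π.symm i, by simp⟩
  rw [value, huniv, ← Equiv.sum_comp π]
  exact Finset.sum_congr rfl fun j _ => by rw [arrival_ofFn]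

theorem dist_le_tourTime (π : Equiv.Perm (Fin n)) (j : Fin n) :
    I.d none (some (π j)) ≤ I.tourTime π j := by
  have : ∀ m, I.d none (tourNode π m) ≤ ∑ k ∈ Finset.range m, I.tourStep π k := by
    intro m
    induction m with
    | zero => simp [tourNode, I.d_self]
    | succ m ih =>
      rw [Finset.sum_range_succ]
      exact (I.d_triangle _ (tourNode π m) _).trans (add_le_add_left ih _)
  simpa [tourNode_succ, tourTime] using this (j + 1)

/-! ### The half length and the guess of the scale -/

theorem halfLength_pos : 0 < I.halfLength := by
  refine Real.logb_pos ?_ one_lt_two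
  rw [lt_div_iff₀ I.γ_pos, one_mul]
  exact I.γ_lt_one

theorem rpow_halfLength : I.γ ^ I.halfLength = 1 / 2 := by
  have h : (1 / I.γ) ^ I.halfLength = 2 := by
    refine Real.rpow_logb (one_div_pos.2 I.γ_pos) ?_ two_pos
    rw [Ne, div_eq_one_iff_eq I.γ_pos.ne']
    exact I.γ_lt_one.ne'
  rw [one_div, Real.inv_rpow I.γ_pos.le] at h
  rw [one_div, ← h, inv_inv]

/-- One of the guesses `n / 2 ^ i` is correct up to a factor of two. -/
theorem exists_guess {k : ℕ} (hn : 2 ≤ n) (hk : 1 ≤ k) (hkn : k ≤ n) :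
    ∃ i ∈ Finset.Icc 1 (Nat.log 2 n), k * 2 ^ i ≤ 2 * n ∧ n ≤ 2 * k * 2 ^ i ∧ 2 ^ i ≤ n := by
  set P : ℕ → Prop := fun i => k * 2 ^ i ≤ 2 * n
  have hlog : 1 ≤ Nat.log 2 n := Nat.log_pos one_lt_two hn
  have hP1 : P 1 := by change k * 2 ^ 1 ≤ 2 * n; omega
  set i := Nat.findGreatest P (Nat.log 2 n) with hi
  have hi1 : 1 ≤ i := Nat.le_findGreatest hlog hP1
  have hil : i ≤ Nat.log 2 n := Nat.findGreatest_le _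
  refine ⟨i, Finset.mem_Icc.2 ⟨hi1, hil⟩, Nat.findGreatest_spec (P := P) hlog hP1, ?_, ?_⟩
  · rcases hil.eq_or_lt with h | h
    · have := Nat.lt_pow_succ_log_self one_lt_two n
      rw [← h, pow_succ] at this
      nlinarith [Nat.pos_of_ne_zero (pow_ne_zero i (two_ne_zero (α := ℕ)))]
    · have : ¬ k * 2 ^ (i + 1) ≤ 2 * n := Nat.findGreatest_is_greatest (P := P) (Nat.lt_succ_self i) h
      rw [pow_succ] at this
      nlinarith
  · exact (Nat.pow_le_pow_right two_pos hil).trans (Nat.pow_log_le_self 2 (by omega))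

/-! ### The value of RDFS on a segment of a tour -/

/-- If a segment `S` of a tour has length at most `x` and `n' = n / 2 ^ i` is close to its number
`k` of rewards, then at most `√n'` of its steps are long, so that RDFS started at a random reward of
the segment collects about `√k` rewards. -/
theorem le_sum_value_rdfs (τ σ : Selector n) (π : Equiv.Perm (Fin n)) {S : Finset (Fin n)}
    (hS : S.Nonempty) {T : ℝ} (hT : ∀ j ∈ S, I.tourTime π j ≤ T)
    (hx : ∀ j ∈ S, ∀ j' ∈ S, I.tourTime π j' - I.tourTime π j ≤ I.halfLength)
    {i : ℕ} (hi : S.card * 2 ^ i ≤ 2 * n) (hi' : n ≤ 2 * S.card * 2 ^ i) (hi'' : 2 ^ i ≤ n) :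
    I.γ ^ T * (S.card * √S.card) / 128 ≤ ∑ s₁, I.value (I.rdfs τ σ (I.threshold i) s₁) := by
  set k : ℝ := (S.card : ℝ) with hk
  set n' : ℝ := (n : ℝ) / 2 ^ i with hn'
  set x := I.halfLength with hxdef
  set θ := I.threshold i with hθdef
  set e := I.tourStep π with he
  have h2i : (0 : ℝ) < 2 ^ i := by positivity
  have hk1 : 1 ≤ k := by
    rw [hk]
    exact_mod_cast Finset.card_pos.2 hS
  have hxpos : 0 < x := I.halfLength_pos
  have hn1 : 1 ≤ n' := by
    rw [hn', le_div_iff₀ h2i, one_mul]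
    exact_mod_cast hi''
  have hnk : k ≤ 2 * n' := by
    rw [hk, hn', ← mul_div_assoc, le_div_iff₀ h2i]
    exact_mod_cast hi
  have hkn : n' ≤ 2 * k := by
    rw [hk, hn', div_le_iff₀ h2i]
    exact_mod_cast hi'
  set q := √n' with hq
  set r := √k with hr
  have hq1 : 1 ≤ q := Real.one_le_sqrt.2 hn1
  have hr1 : 1 ≤ r := Real.one_le_sqrt.2 hk1
  have hqq : q * q = n' := Real.mul_self_sqrt (by linarith)
  have hrr : r * r = k := Real.mul_self_sqrt (by linarith)
  have hqr : 2 * q ≤ 3 * r := by nlinarith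
  have hrq : r / 8 ≤ q := by nlinarith
  have hθq : θ * q = x := by
    rw [hθdef, threshold, ← hn', ← hq, div_mul_cancel₀]
    linarith
  have hθ : 0 < θ := by
    rw [hθdef, threshold]
    exact div_pos hxpos (by rw [← hn', ← hq]; linarith)
  set b : Fin n → ℕ := fun j => longSteps e θ (j + 1) with hb
  -- The segment has at most `√n' + 1` blocks: each long step uses up `x / √n'` of its length.
  have hblocks : ((S.image b).card : ℝ) ≤ q + 1 := by
    refine card_image_le_of_sub_le hS b fun a ha c hc => ?_
    rcases le_total (c : ℕ) (a : ℕ) with h | h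
    · have : (b c : ℝ) ≤ b a := by
        exact_mod_cast longSteps_mono e θ (Nat.succ_le_succ h)
      linarith
    · have h1 := mul_longSteps_sub_le (I.tourStep_nonneg π) θ (Nat.succ_le_succ h)
      have h2 : θ * ((b c : ℝ) - b a) ≤ θ * q := by
        rw [hθq]
        exact h1.trans (hx a ha c hc)
      exact le_of_mul_le_mul_left h2 hθ
  have hstart : ∀ j ∈ S, I.γ ^ T / 8 * min (r / 8) ((S.filter fun u => b u = b j).card : ℝ) ≤
      I.value (I.rdfs τ σ θ (π j)) := by
    intro j hj
    set F := (S.filter fun u => b u = b j).map π.toEmbedding with hF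
    have hv := I.le_value_rdfs τ σ hθ (π j) ⌈q⌉₊ F ?_
    · refine le_trans ?_ hv
      have hc1 : q ≤ ⌈q⌉₊ := Nat.le_ceil q
      have hc2 : (⌈q⌉₊ : ℝ) ≤ q + 1 := (Nat.ceil_lt_add_one (by linarith)).le
      have hFc : (F.card : ℝ) = (S.filter fun u => b u = b j).card := by
        rw [hF, Finset.card_map]
      have hpow : I.γ ^ T / 4 ≤ I.γ ^ (I.d none (some (π j)) + ⌈q⌉₊ * θ) := by
        have : I.γ ^ (T + (x + x)) = I.γ ^ T / 4 := by
          rw [Real.rpow_add I.γ_pos, Real.rpow_add I.γ_pos, I.rpow_halfLength]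
          ring
        rw [← this]
        refine Real.rpow_le_rpow_of_exponent_ge I.γ_pos I.γ_lt_one.le ?_
        have h1 := (I.dist_le_tourTime π j).trans (hT j hj)
        have h2 : (⌈q⌉₊ : ℝ) * θ ≤ (q + q) * θ :=
          mul_le_mul_of_nonneg_right (by linarith) hθ.le
        linarith
      have hmin : min (r / 8) ((S.filter fun u => b u = b j).card : ℝ) ≤
          min (⌈q⌉₊ : ℝ) F.card := by
        rw [hFc]
        exact min_le_min_right _ (hrq.trans hc1)
      have hmin0 : 0 ≤ min (r / 8) ((S.filter fun u => b u = b j).card : ℝ) :=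
        le_min (by linarith) (by positivity)
      have hγ : 0 ≤ I.γ ^ T := Real.rpow_nonneg I.γ_pos.le _
      calc _ = min (r / 8) ((S.filter fun u => b u = b j).card : ℝ) / 2 * (I.γ ^ T / 4) := by ring
        _ ≤ _ := by gcongr
    · -- Rewards in the same block are joined by the short steps of the tour between them.
      intro V hjV hV u hu
      obtain ⟨l, hl, rfl⟩ := Finset.mem_map.1 hu
      have hbl : b l = b j := (Finset.mem_filter.1 hl).2
      set Q : ℕ → Prop := fun m => ∃ v ∈ V, tourNode π m = some v with hQ
      have hQV : ∀ a : Fin n, Q (a + 1) ↔ π a ∈ V := by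
        intro a
        simp [hQ, tourNode_succ]
      have hstep : ∀ m, 1 ≤ m → m < n → e m < θ → (Q m ↔ Q (m + 1)) := by
        intro m hm1 hmn hem
        obtain ⟨m, rfl⟩ : ∃ m', m = m' + 1 := ⟨m - 1, by omega⟩
        have h1 := hQV ⟨m, by omega⟩
        have h2 := hQV ⟨m + 1, hmn⟩
        have hd : I.d (some (π ⟨m, by omega⟩)) (some (π ⟨m + 1, hmn⟩)) < θ := by
          rw [← tourNode_succ, ← tourNode_succ]
          exact hem
        simp only at h1 h2
        rw [h1, h2]
        exact ⟨fun h => hV _ h _ hd, fun h => hV _ h _ (by rwa [I.d_symm])⟩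
      change π l ∈ V
      rcases le_total (l : ℕ) (j : ℕ) with h | h
      · rw [← hQV, iff_of_longSteps_eq (Nat.succ_pos _) (Nat.succ_le_succ h) j.2 hstep hbl]
        exact (hQV j).2 hjV
      · rw [← hQV, ← iff_of_longSteps_eq (Nat.succ_pos _) (Nat.succ_le_succ h) l.2 hstep hbl.symm]
        exact (hQV j).2 hjV
  calc I.γ ^ T * (k * r) / 128 ≤ I.γ ^ T / 8 * (r / 8 * k - (q + 1) * (r / 8) ^ 2) := by
        have hγ : 0 ≤ I.γ ^ T := Real.rpow_nonneg I.γ_pos.le _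
        have : k * r / 16 ≤ r / 8 * k - (q + 1) * (r / 8) ^ 2 := by
          have : (q + 1) * (r / 8) ^ 2 ≤ 3 * r * (r / 8) ^ 2 :=
            mul_le_mul_of_nonneg_right (by linarith) (sq_nonneg _)
          rw [← hrr]
          nlinarith [pow_pos (lt_of_lt_of_le one_pos hr1) 3]
        calc _ = I.γ ^ T / 8 * (k * r / 16) := by ring
          _ ≤ _ := by gcongr
    _ ≤ I.γ ^ T / 8 * ∑ j ∈ S, min (r / 8) ((S.filter fun u => b u = b j).card : ℝ) := by
        have hγ : 0 ≤ I.γ ^ T := Real.rpow_nonneg I.γ_pos.le _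
        gcongr
        exact le_sum_min_card_fiber S b (r / 8) hblocks
    _ ≤ ∑ j ∈ S, I.value (I.rdfs τ σ θ (π j)) := by
        rw [Finset.mul_sum]
        exact Finset.sum_le_sum hstart
    _ ≤ ∑ j, I.value (I.rdfs τ σ θ (π j)) :=
        Finset.sum_le_sum_of_subset_of_nonneg (Finset.subset_univ _) fun _ _ _ => I.value_nonneg _
    _ = _ := Equiv.sum_comp π fun s => I.value (I.rdfs τ σ θ s)

/-! ### Choice of a segment and the two bounds -/

/-- Cut the arrival times into segments of length `x`. Giving segment `l` the weight `(4 / 5) ^ l`,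
which is summable, some segment carries at least its share of the total value. A geometric weight
needs no cutoff of late segments, and so loses no logarithm. -/
theorem exists_segment {ι : Type*} [Fintype ι] [Nonempty ι] {γ x D : ℝ} (hγ : 0 < γ)
    (hγ1 : γ < 1) (hx : 0 < x) (hγx : γ ^ x = 1 / 2) (t : ι → ℝ) (hD : ∀ j, D ≤ t j) :
    ∃ (l : ℕ) (S : Finset ι), S.Nonempty ∧ (∀ j ∈ S, t j ≤ D + (l + 1) * x) ∧
      (∀ j ∈ S, ∀ j' ∈ S, t j' - t j ≤ x) ∧
      (∑ j, γ ^ t j) / 5 * (4 / 5) ^ l ≤ γ ^ D * (1 / 2) ^ l * S.card := by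
  classical
  set f : ι → ℕ := fun j => ⌊(t j - D) / x⌋₊ with hf
  have hlow : ∀ j, D + f j * x ≤ t j := by
    intro j
    have := Nat.floor_le (div_nonneg (sub_nonneg.2 (hD j)) hx.le)
    rw [le_div_iff₀ hx] at this
    linarith
  have hup : ∀ j, t j ≤ D + (f j + 1) * x := by
    intro j
    have := (Nat.lt_floor_add_one ((t j - D) / x)).le
    rw [div_le_iff₀ hx] at this
    linarith
  have hterm : ∀ j, γ ^ t j ≤ γ ^ D * (1 / 2) ^ f j := by
    intro j
    refine (Real.rpow_le_rpow_of_exponent_ge hγ hγ1.le (hlow j)).trans (le_of_eq ?_)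
    rw [Real.rpow_add hγ, mul_comm (f j : ℝ) x, Real.rpow_mul_natCast hγ.le, hγx]
  by_contra hcon
  push Not at hcon
  set A := ∑ j, γ ^ t j with hA
  have hA0 : 0 ≤ A := Finset.sum_nonneg fun _ _ => Real.rpow_nonneg hγ.le _
  have hlt : ∀ l ∈ Finset.univ.image f,
      (Finset.univ.filter fun j => f j = l).card • (γ ^ D * (1 / 2) ^ l) < A / 5 * (4 / 5) ^ l := by
    intro l hl
    obtain ⟨j₀, -, hj₀⟩ := Finset.mem_image.1 hl
    rw [nsmul_eq_mul, mul_comm]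
    refine hcon l (Finset.univ.filter fun j => f j = l) ⟨j₀, by simp [hj₀]⟩ ?_ ?_
    · intro j hj
      rw [← (Finset.mem_filter.1 hj).2]
      exact hup j
    · intro j hj j' hj'
      have h1 := hlow j
      have h2 := hup j'
      rw [(Finset.mem_filter.1 hj).2] at h1
      rw [(Finset.mem_filter.1 hj').2] at h2
      linarith
  have hgeo : ∑ l ∈ Finset.univ.image f, (4 / 5 : ℝ) ^ l ≤ 5 := by
    refine ((summable_geometric_of_lt_one (by norm_num) (by norm_num)).sum_le_tsum _
      fun _ _ => by positivity).trans ?_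
    rw [tsum_geometric_of_lt_one (by norm_num) (by norm_num)]
    norm_num
  have : A < A := calc
    A ≤ ∑ j, γ ^ D * (1 / 2) ^ f j := Finset.sum_le_sum fun j _ => hterm j
    _ = ∑ l ∈ Finset.univ.image f,
        (Finset.univ.filter fun j => f j = l).card • (γ ^ D * (1 / 2) ^ l) :=
      Finset.sum_comp (fun l => γ ^ D * (1 / 2) ^ l) f
    _ < ∑ l ∈ Finset.univ.image f, A / 5 * (4 / 5) ^ l :=
      Finset.sum_lt_sum_of_nonempty (Finset.univ_nonempty.image f) hlt
    _ = A / 5 * ∑ l ∈ Finset.univ.image f, (4 / 5) ^ l := by rw [Finset.mul_sum]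
    _ ≤ A / 5 * 5 := by gcongr
    _ = A := by ring
  exact lt_irrefl _ this

theorem value_nn_le_nnRdfs (τ σ : Selector n) : I.value (I.nn τ []) / 2 ≤ I.nnRdfs τ σ := by
  have : 0 ≤ 1 / 2 * (1 / (n : ℝ) * ∑ s₁ : Fin n,
      (1 / (Nat.log 2 n : ℝ) * ∑ i ∈ Finset.Icc 1 (Nat.log 2 n),
        I.value (I.rdfs τ σ (I.threshold i) s₁))) :=
    mul_nonneg (by norm_num) <| mul_nonneg (by positivity) <| Finset.sum_nonneg fun _ _ =>
      mul_nonneg (by positivity) <| Finset.sum_nonneg fun _ _ => I.value_nonneg _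
  rw [nnRdfs]
  linarith

theorem sum_value_rdfs_le (τ σ : Selector n) (hn : 2 ≤ n) {i : ℕ}
    (hi : i ∈ Finset.Icc 1 (Nat.log 2 n)) :
    ∑ s₁, I.value (I.rdfs τ σ (I.threshold i) s₁) / 2 ≤
      n * Nat.log 2 n * I.nnRdfs τ σ := by
  have hn0 : (0 : ℝ) < n := by exact_mod_cast (by omega : 0 < n)
  have hL0 : (0 : ℝ) < Nat.log 2 n := by exact_mod_cast Nat.log_pos one_lt_two hn
  have h1 : 0 ≤ I.value (I.nn τ []) := I.value_nonneg _
  calc _ ≤ ∑ s₁, (∑ i ∈ Finset.Icc 1 (Nat.log 2 n),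
        I.value (I.rdfs τ σ (I.threshold i) s₁)) / 2 := by
        gcongr with s₁
        exact Finset.single_le_sum
          (f := fun i => I.value (I.rdfs τ σ (I.threshold i) s₁)) (fun _ _ => I.value_nonneg _) hi
    _ ≤ n * Nat.log 2 n * (1 / 2 * I.value (I.nn τ [])) + ∑ s₁, (∑ i ∈ Finset.Icc 1 (Nat.log 2 n),
        I.value (I.rdfs τ σ (I.threshold i) s₁)) / 2 := by
        have : 0 ≤ n * Nat.log 2 n * (1 / 2 * I.value (I.nn τ [])) := by positivity
        linarith
    _ = _ := by
        rw [nnRdfs, ← Finset.mul_sum, ← Finset.sum_div]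
        field_simp

/-- The two lower bounds for NN-RDFS in terms of one segment of a tour, with `k` rewards and
discount about `p * (1 / 2) ^ l`; here `p` is the discount of a reward nearest to `s₀`. -/
theorem exists_segment_bounds (τ σ : Selector n) (hn : 2 ≤ n) (π : Equiv.Perm (Fin n)) :
    ∃ (p k : ℝ) (l : ℕ), 0 < p ∧ p ≤ 1 ∧ 1 ≤ k ∧ k ≤ n ∧
      I.value (List.ofFn π) / 5 * (4 / 5) ^ l ≤ p * (1 / 2) ^ l * k ∧
      p / 2 ≤ I.nnRdfs τ σ ∧
      p * (1 / 2) ^ l * (k * √k) / 512 ≤ n * Nat.log 2 n * I.nnRdfs τ σ := by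
  have : Nonempty (Fin n) := ⟨⟨0, by omega⟩⟩
  obtain ⟨i₀, hi₀, hnn⟩ := I.exists_nearest_le_value_nn τ (by omega)
  obtain ⟨l, S, hS, hT, hx, hval⟩ := exists_segment I.γ_pos I.γ_lt_one I.halfLength_pos
    I.rpow_halfLength (I.tourTime π) fun j => (hi₀ (π j)).trans (I.dist_le_tourTime π j)
  have hSn : S.card ≤ n := by simpa using Finset.card_le_univ S
  obtain ⟨i, hi, hi1, hi2, hi3⟩ := exists_guess hn (Finset.card_pos.2 hS) hSn
  refine ⟨I.γ ^ I.d none (some i₀), S.card, l, Real.rpow_pos_of_pos I.γ_pos _,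
    Real.rpow_le_one I.γ_pos.le I.γ_lt_one.le (I.d_nonneg _ _),
    by exact_mod_cast Finset.card_pos.2 hS, by exact_mod_cast hSn, ?_, ?_, ?_⟩
  · rwa [value_ofFn]
  · linarith [I.value_nn_le_nnRdfs τ σ]
  · refine le_trans ?_ (I.sum_value_rdfs_le τ σ hn hi)
    have h := I.le_sum_value_rdfs τ σ π hS hT hx hi1 hi2 hi3
    have hl : ((l : ℝ) + 1) = ((l + 1 : ℕ) : ℝ) := by push_cast; rfl
    rw [Real.rpow_add I.γ_pos, hl, mul_comm _ I.halfLength, Real.rpow_mul_natCast I.γ_pos.le,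
      I.rpow_halfLength, pow_succ] at h
    rw [← Finset.sum_div]
    linarith

theorem exists_value_eq_opt : ∃ π : Equiv.Perm (Fin n), I.value (List.ofFn π) = I.opt :=
  exists_eq_ciSup_of_finite

theorem opt_nonneg : 0 ≤ I.opt := by
  obtain ⟨π, hπ⟩ := I.exists_value_eq_opt
  exact hπ ▸ I.value_nonneg _

theorem opt_le : I.opt ≤ n := by
  obtain ⟨π, hπ⟩ := I.exists_value_eq_opt
  rw [← hπ, value_ofFn]
  refine (Finset.sum_le_card_nsmul _ _ 1 fun j _ => ?_).trans (by simp)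
  exact Real.rpow_le_one I.γ_pos.le I.γ_lt_one.le
    ((I.d_nonneg _ _).trans (I.dist_le_tourTime π j))

theorem natLog_le_two_mul_log (n : ℕ) : (Nat.log 2 n : ℝ) ≤ 2 * Real.log n := by
  have h := Real.natLog_le_logb n 2
  have h2 := Real.log_two_gt_d9
  have h0 : 0 ≤ Real.log n := Real.log_natCast_nonneg n
  refine h.trans ?_
  rw [Real.logb, div_le_iff₀ (by push_cast; linarith)]
  push_cast
  nlinarith

theorem half_le_log (hn : 2 ≤ n) : 1 / 2 ≤ Real.log n := by
  have h2 := Real.log_two_gt_d9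
  have : Real.log 2 ≤ Real.log n := Real.log_le_log two_pos (by exact_mod_cast hn)
  linarith

/-- The bound for instances with `α * n ≤ opt`: the chosen segment has at least `α * n / 5` rewards
and a discount bounded below in terms of `α`. -/
theorem le_nnRdfs_of_le_opt {α : ℝ} (hα : 0 < α) (τ σ : Selector n) (hn : 2 ≤ n)
    (h : α * n ≤ I.opt) :
    (α / 5) ^ 3 * √(α / 5) / 2048 * ((n : ℝ) ^ (-(1 / 2) : ℝ) / Real.log (n : ℝ) ^ 2) * I.opt ≤
      I.nnRdfs τ σ := by
  obtain ⟨π, hπ⟩ := I.exists_value_eq_opt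
  obtain ⟨p, k, l, hp0, hp1, hk1, hkn, hval, -, hN⟩ := I.exists_segment_bounds τ σ hn π
  rw [hπ] at hval
  set N := I.nnRdfs τ σ
  set β := α / 5 with hβ
  have hβ0 : 0 < β := by positivity
  have hn0 : (0 : ℝ) < n := by exact_mod_cast (by omega : 0 < n)
  set g : ℝ := (8 / 5) ^ l with hg
  have hg1 : 1 ≤ g := one_le_pow₀ (by norm_num)
  have hpow : (4 / 5 : ℝ) ^ l = g * (1 / 2) ^ l := by
    rw [hg, ← mul_pow]
    norm_num
  have h2l : (0 : ℝ) < (1 / 2) ^ l := by positivity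
  have hpk : β * n * g ≤ p * k := by
    have h1 : β * n * g * (1 / 2) ^ l ≤ p * k * (1 / 2) ^ l := by
      have : α * n / 5 * (4 / 5) ^ l ≤ I.opt / 5 * (4 / 5) ^ l := by gcongr
      rw [hpow] at this hval
      rw [hβ]
      linarith
    exact le_of_mul_le_mul_right h1 h2l
  have hk : β * n ≤ k := by nlinarith [mul_pos hβ0 hn0]
  have hβg : β * g ≤ 1 := by nlinarith
  have hdisc : β ^ 2 ≤ (1 / 2) ^ l := by
    have h1 : 1 ≤ (1 / 2) ^ l * g ^ 2 := by
      rw [hg, ← pow_mul, mul_comm l 2, pow_mul, ← mul_pow]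
      exact one_le_pow₀ (by norm_num)
    have h2 : (β * g) ^ 2 ≤ 1 := pow_le_one₀ (by positivity) hβg
    have h3 : β ^ 2 * g ^ 2 ≤ (1 / 2) ^ l * g ^ 2 := by linarith [mul_pow β g 2]
    exact le_of_mul_le_mul_right h3 (by positivity)
  have hpk' : β * n ≤ p * k := by nlinarith [mul_pos hβ0 hn0]
  have hsq : √β * √n ≤ √k := by
    rw [← Real.sqrt_mul hβ0.le]
    exact Real.sqrt_le_sqrt hk
  have hlog := natLog_le_two_mul_log n
  have hlog2 := half_le_log hn
  set Λ := Real.log n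
  have hmain : β ^ 2 * (β * n) * (√β * √n) / 512 ≤ n * (2 * Λ) * N := by
    have h1 : β ^ 2 * (β * n) * (√β * √n) ≤ (1 / 2) ^ l * (p * k) * √k := by gcongr
    have hN0 : 0 ≤ N := le_trans (by have := I.value_nonneg (I.nn τ []); positivity)
      (I.value_nn_le_nnRdfs τ σ)
    have h2 : n * Nat.log 2 n * N ≤ n * (2 * Λ) * N := by gcongr
    linarith
  have hsn : (0 : ℝ) < √n := Real.sqrt_pos.2 hn0
  have hΛN : β ^ 3 * √β * √n / 1024 ≤ Λ * N := by
    refine le_of_mul_le_mul_left ?_ hn0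
    linarith
  have hrpow : (n : ℝ) ^ (-(1 / 2) : ℝ) = 1 / √n := by
    rw [Real.rpow_neg hn0.le, ← Real.sqrt_eq_rpow, one_div]
  have hc : 0 ≤ β ^ 3 * √β / 2048 := by positivity
  calc _ ≤ β ^ 3 * √β / 2048 * ((n : ℝ) ^ (-(1 / 2) : ℝ) / Λ ^ 2) * n := by
        have := I.opt_le
        gcongr
    _ = β ^ 3 * √β * √n / 1024 / (2 * Λ ^ 2) := by
        rw [hrpow]
        nth_rw 2 [← Real.mul_self_sqrt hn0.le]
        field_simp
        norm_num
    _ ≤ Λ * N / (2 * Λ ^ 2) := by gcongr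
    _ ≤ N := by
        have hN0 : 0 ≤ N := le_trans (by have := I.value_nonneg (I.nn τ []); positivity)
          (I.value_nn_le_nnRdfs τ σ)
        rw [div_le_iff₀ (by positivity)]
        nlinarith [mul_nonneg hN0 (by linarith : 0 ≤ Λ)]

/-- The bound for all instances. The bounds `p / 2` for NN and `p * 2⁻ˡ * k * √k / (n log n)` for
RDFS balance at `k = n ^ (2 / 3)`; multiplying the square of the second by the first eliminates
`k`. The weight `4 / 5` of `exists_segment` is chosen so that `2 * (4 / 5) ^ 3 ≥ 1`, whence `l`
drops out, too. -/
theorem le_nnRdfs (τ σ : Selector n) (hn : 2 ≤ n) :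
    1 / 2000 * ((n : ℝ) ^ (-(2 / 3) : ℝ) / Real.log (n : ℝ) ^ 2) * I.opt ≤ I.nnRdfs τ σ := by
  obtain ⟨π, hπ⟩ := I.exists_value_eq_opt
  obtain ⟨p, k, l, hp0, hp1, hk1, hkn, hval, hNN, hN⟩ := I.exists_segment_bounds τ σ hn π
  rw [hπ] at hval
  have hO := I.opt_nonneg
  set N := I.nnRdfs τ σ
  set O := I.opt
  have hN0 : 0 ≤ N := by linarith
  have hn0 : (0 : ℝ) < n := by exact_mod_cast (by omega : 0 < n)
  have hlog := natLog_le_two_mul_log n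
  have hlog2 := half_le_log hn
  set Λ := Real.log n
  set h : ℝ := (1 / 2) ^ l with hh
  have h0 : 0 < h := by positivity
  have hk0 : 0 < k := by linarith
  have hcube : (O / 5) ^ 3 * h ≤ (p * h * k) ^ 3 := by
    have h1 : (O / 5 * (4 / 5) ^ l) ^ 3 ≤ (p * h * k) ^ 3 := by gcongr
    refine le_trans ?_ h1
    rw [mul_pow]
    gcongr
    rw [← pow_mul, mul_comm l 3, pow_mul, hh]
    exact pow_le_pow_left₀ (by norm_num) (by norm_num) l
  have hprod : (p * h * (k * √k) / 512) ^ 2 * (p / 2) ≤ (n * (2 * Λ) * N) ^ 2 * N := by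
    have h2 : p * h * (k * √k) / 512 ≤ n * (2 * Λ) * N := hN.trans (by gcongr)
    gcongr
  have hO3 : O ^ 3 / (125 * 512 ^ 2 * 8) ≤ (n * Λ) ^ 2 * N ^ 3 := by
    have h1 : (p * h * (k * √k)) ^ 2 * p * h = (p * h * k) ^ 3 := by
      have : √k ^ 2 = k := Real.sq_sqrt hk0.le
      calc _ = p ^ 3 * h ^ 3 * k ^ 2 * √k ^ 2 := by ring
        _ = _ := by rw [this]; ring
    have h2 : (O / 5) ^ 3 ≤ (p * h * (k * √k)) ^ 2 * p := by
      refine le_of_mul_le_mul_right ?_ h0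
      rwa [h1]
    have h3 : (n * (2 * Λ) * N) ^ 2 * N = 4 * ((n * Λ) ^ 2 * N ^ 3) := by ring
    rw [h3] at hprod
    linarith
  have hrpow : ((n : ℝ) ^ (-(2 / 3) : ℝ)) ^ 3 = 1 / (n : ℝ) ^ 2 := by
    rw [← Real.rpow_mul_natCast hn0.le, one_div, ← Real.rpow_natCast (n : ℝ) 2,
      ← Real.rpow_neg hn0.le]
    norm_num
  have hΛ : 1 / 16 * Λ ^ 2 ≤ Λ ^ 6 := by
    have : (1 / 2) ^ 4 ≤ Λ ^ 4 := by gcongr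
    nlinarith [sq_nonneg Λ]
  refine le_of_pow_le_pow_left₀ three_ne_zero hN0 ?_
  calc _ = O ^ 3 / (2000 ^ 3 * (n ^ 2 * Λ ^ 6)) := by
        rw [mul_pow, mul_pow, div_pow, div_pow, hrpow]
        field_simp
    _ ≤ O ^ 3 / (2000 ^ 3 * (n ^ 2 * (1 / 16 * Λ ^ 2))) := by gcongr
    _ = O ^ 3 / (125 * 512 ^ 2 * 8) * (125 * 512 ^ 2 * 8 * 16 / 2000 ^ 3) / (n * Λ) ^ 2 := by
        field_simp
    _ ≤ O ^ 3 / (125 * 512 ^ 2 * 8) * 1 / (n * Λ) ^ 2 := by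
        gcongr
        norm_num
    _ ≤ N ^ 3 := by
        rw [mul_one, div_le_iff₀ (by positivity)]
        linarith

end RDTSP

theorem theorem5 :
    (∀ α : ℝ, 0 < α → ∃ c : ℝ, 0 < c ∧
      ∀ n : ℕ, 2 ≤ n → ∀ (I : RDTSP n) (τ σ : Selector n), α * (n : ℝ) ≤ I.opt →
        c * ((n : ℝ) ^ (-(1 / 2) : ℝ) / Real.log (n : ℝ) ^ 2) * I.opt ≤ I.nnRdfs τ σ) ∧
    (∃ c : ℝ, 0 < c ∧
      ∀ n : ℕ, 2 ≤ n → ∀ (I : RDTSP n) (τ σ : Selector n),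
        c * ((n : ℝ) ^ (-(2 / 3) : ℝ) / Real.log (n : ℝ) ^ 2) * I.opt ≤ I.nnRdfs τ σ) := by
  refine ⟨fun α hα => ⟨(α / 5) ^ 3 * √(α / 5) / 2048, by positivity, ?_⟩,
    ⟨1 / 2000, by norm_num, ?_⟩⟩
  · exact fun n hn I τ σ h => I.le_nnRdfs_of_le_opt hα τ σ hn h
  · exact fun n hn I τ σ => I.le_nnRdfs τ σ hn
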